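/- Let $X$ be a random variable with values in $[0,1)$ and let $X_0, X_1, X_2, \dots$ be independent random variables distributed as $X$. In the scaled attachment random recursive tree (SARRT) with attachment $X$, the root is labelled $0$ and the parent of each node $i \ge 1$ is the node $\lfloor i X_i \rfloor$. Let $L(n,0) = n$ and $L(n,j+1) = \lfloor L(n,j)\, X_{L(n,j)} \rfloor$, and let $D_n = \min\{ j \ge 0 : L(n,j) = 0 \}$ be the depth of the node $n$. Put $\mu = \mathbf{E}[-\log X] \in (0,\infty]$ (where $-\log 0 = +\infty$) and, if $\mu < \infty$, $\sigma^2 = \mathrm{Var}(-\log X) \in [0,\infty]$. Each $D_n$ is integrable, and the following holds as $n \to \infty$. (A) If $\mu = \infty$, then $D_n/\log n \to 0$ in probability and $\mathbf{E}[D_n]/\log n \to 0$. (B) If $\mu < \infty$, then $D_n/\log n \to 1/\mu$ in probability and $\mathbf{E}[D_n]/\log n \to 1/\mu$. (C) If $\mu < \infty$ and $0 < \sigma^2 < \infty$, then $$\frac{D_n - \log n/\mu}{\sigma \sqrt{\log n/\mu^3}}$$ converges in law to the standard normal distribution $\mathcal{N}(0,1)$. (D) If $\mu < \infty$ and $\sigma^2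 = 0$, then $D_n - \log n/\mu = o(\sqrt{\log n})$ almost surely. -/

import Mathlib

open MeasureTheory ProbabilityTheory Filter Topology Asymptotics
open scoped ENNReal

noncomputable section

namespace Sarrt

/-- `X 0, X 1, X 2, …` are independent random variables with values in `[0, 1)` and common
law `ν`. -/
structure IsAttachmentSequence {Ω : Type*} [MeasurableSpace Ω] (P : Measure Ω) (ν : Measure ℝ)
    (X : ℕ → Ω → ℝ) : Prop where
  measurable : ∀ i, Measurable (X i)
  mem_Ico : ∀ i ω, X i ω ∈ Set.Ico (0 : ℝ) 1
  indep : iIndepFun X P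
  law : ∀ i, P.map (X i) = ν

/-- The parent `⌊i x_i⌋` of the node `i`, given the attachment values `x`. -/
def parent (x : ℕ → ℝ) (i : ℕ) : ℕ := ⌊(i : ℝ) * x i⌋₊

/-- The label `L(n, j)` of the `j`-th ancestor of the node `n`. -/
def label (x : ℕ → ℝ) (n : ℕ) : ℕ → ℕ
  | 0 => n
  | j + 1 => parent x (label x n j)

/-- The depth `min {j ≥ 0 : L(n, j) = 0}` of the node `n`. The set is nonempty when all `x i` are
in `[0, 1)`, because then the labels decrease strictly until they reach the root `0`. -/
def depth (x : ℕ → ℝ) (n : ℕ) : ℕ := sInf {j : ℕ | label x n j = 0}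

/-- `-log x` for `x ∈ [0, 1)`, as an extended nonnegative real, with `-log 0 = ∞`. -/
def negLog (x : ℝ) : ℝ≥0∞ := if x = 0 then ∞ else ENNReal.ofReal (-Real.log x)

/-- `μ = E[-log X] ∈ [0, ∞]` for a random variable `X` with values in `[0, 1)` and law `ν`. -/
def logMean (ν : Measure ℝ) : ℝ≥0∞ := ∫⁻ x, negLog x ∂ν

open Classical in
/-- `σ² = Var(-log X) ∈ [0, ∞]` for `X` of law `ν`, with `σ² = ∞` when `μ = ∞`. When `μ < ∞`,
`X` is almost surely nonzero, so that `-Real.log X` is almost surely the true value. -/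
def logVar (ν : Measure ℝ) : ℝ≥0∞ :=
  if logMean ν = ∞ then ∞ else evariance (fun x : ℝ => -Real.log x) ν

end Sarrt

end

/-! The labels on the path from `n` to the root decrease strictly, so every step uses a fresh
variable. For each fixed `j`, the probability of having reached `0` after `j` steps is therefore
unchanged if the steps use `X (j-1), …, X 0` in this order, whatever the labels are
(`measure_label_eq_zero`). The resulting `revLabel` lies between `n ∏ X i - ∑ k, ∏_{i<k} X i` and `n
∏ X i`, with `i, k < j`. The reversal makes the rounding error a sum independent of `n`, of
expectation at most `1 / (1 - E X)` for every `j`. So, up to a tight error, `D n ≤ j` means that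
`∑_{i<j} log (X i)` is below `-log n`: see `measureReal_lt_depth_le_sum` and
`measureReal_depth_le_sum`.

The law of large numbers for these sums gives convergence in probability; when `μ = ∞` it is applied
to `log (max X δ)`, whose mean tends to `-∞` as `δ → 0`. The central limit theorem at `j ≈ log n / μ
+ c √(log n / μ)` gives the normal limit. Expectations converge because `P (D n > j) ≤ n (E X) ^ j`
makes the excess of `D n` over a multiple of `log n` bounded in mean
(`exists_integral_depth_excess_le`). If the variance is zero, `X` is almost surely constant and the
two bounds on `revLabel` determine the depth up to `O(1)`. -/

namespace Sarrt

/-! ### Labels, the reversed walk, and its comparison with products. -/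

section Deterministic

variable {x y : ℕ → ℝ}

lemma parent_le (hx : ∀ i, x i ∈ Set.Ico (0 : ℝ) 1) (i : ℕ) : parent x i ≤ i := by
  refine Nat.floor_le_of_le ?_
  have := hx i
  exact mul_le_of_le_one_right (Nat.cast_nonneg i) this.2.le

lemma parent_lt (hx : ∀ i, x i ∈ Set.Ico (0 : ℝ) 1) {i : ℕ} (hi : i ≠ 0) : parent x i < i := by
  rw [parent, Nat.floor_lt (mul_nonneg (Nat.cast_nonneg i) (hx i).1)]
  have : (0 : ℝ) < i := by positivity
  nlinarith [(hx i).2]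

@[simp] lemma parent_zero (x : ℕ → ℝ) : parent x 0 = 0 := by simp [parent]

lemma label_succ_eq_label_parent (x : ℕ → ℝ) (n j : ℕ) :
    label x n (j + 1) = label x (parent x n) j := by
  induction j with
  | zero => rfl
  | succ j ih =>
    rw [label, ih]
    rfl

@[simp] lemma label_zero_left (x : ℕ → ℝ) (j : ℕ) : label x 0 j = 0 := by
  induction j with
  | zero => rfl
  | succ j ih => rw [label, ih, parent_zero]

lemma label_le (hx : ∀ i, x i ∈ Set.Ico (0 : ℝ) 1) (n j : ℕ) : label x n j ≤ n := by
  induction j with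
  | zero => exact le_rfl
  | succ j ih => exact (parent_le hx _).trans ih

lemma label_self (hx : ∀ i, x i ∈ Set.Ico (0 : ℝ) 1) (n : ℕ) : label x n n = 0 := by
  have key : ∀ j, label x n j ≤ n - j := by
    intro j
    induction j with
    | zero => simp [label]
    | succ j ih =>
      by_cases h : label x n j = 0
      · rw [label, h, parent_zero]
        exact Nat.zero_le _
      · have : label x n (j + 1) < label x n j := parent_lt hx h
        omega
  simpa using key n

lemma label_eq_zero_of_le {n j k : ℕ} (h : label x n j = 0) (hjk : j ≤ k) : label x n k = 0 := by
  induction k, hjk using Nat.le_induction with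
  | base => exact h
  | succ k _ ih => rw [label, ih, parent_zero]

lemma depth_le_iff (hx : ∀ i, x i ∈ Set.Ico (0 : ℝ) 1) {n j : ℕ} :
    depth x n ≤ j ↔ label x n j = 0 := by
  have hne : {j : ℕ | label x n j = 0}.Nonempty := ⟨n, label_self hx n⟩
  exact ⟨fun h => label_eq_zero_of_le (Nat.sInf_mem hne) h, fun h => Nat.sInf_le h⟩

lemma depth_le_self (hx : ∀ i, x i ∈ Set.Ico (0 : ℝ) 1) (n : ℕ) : depth x n ≤ n :=
  (depth_le_iff hx).2 (label_self hx n)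

/-- The walk from `n` never visits a label above `n`. -/
lemma label_congr (hx : ∀ i, x i ∈ Set.Ico (0 : ℝ) 1) {n : ℕ} (h : ∀ i ≤ n, x i = y i) (j : ℕ) :
    label x n j = label y n j := by
  induction j with
  | zero => rfl
  | succ j ih =>
    rw [label, label, ← ih, parent, parent, h _ (label_le hx n j)]

/-- The label reached from `n` after `j` steps when the step at distance `i` from the end
uses the attachment value `x i`, regardless of the current label. -/
noncomputable def revLabel (x : ℕ → ℝ) : ℕ → ℕ → ℕ
  | n, 0 => n
  | n, j + 1 => revLabel x ⌊(n : ℝ) * x j⌋₊ j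

lemma revLabel_zero_left (x : ℕ → ℝ) (j : ℕ) : revLabel x 0 j = 0 := by
  induction j with
  | zero => rfl
  | succ j ih => simpa [revLabel] using ih

lemma revLabel_congr {j : ℕ} (h : ∀ i < j, x i = y i) (n : ℕ) :
    revLabel x n j = revLabel y n j := by
  induction j generalizing n with
  | zero => rfl
  | succ j ih =>
    rw [revLabel, revLabel, h j j.lt_succ_self, ih fun i hi => h i (hi.trans j.lt_succ_self)]

lemma revLabel_le (hx : ∀ i, 0 ≤ x i) (n j : ℕ) :
    (revLabel x n j : ℝ) ≤ n * ∏ i ∈ Finset.range j, x i := by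
  induction j generalizing n with
  | zero => simp [revLabel]
  | succ j ih =>
    rw [revLabel, Finset.prod_range_succ]
    refine (ih _).trans ?_
    have h1 : (⌊(n : ℝ) * x j⌋₊ : ℝ) ≤ n * x j :=
      Nat.floor_le (mul_nonneg (Nat.cast_nonneg n) (hx j))
    have h2 : 0 ≤ ∏ i ∈ Finset.range j, x i := Finset.prod_nonneg fun i _ => hx i
    calc _ ≤ (n * x j) * ∏ i ∈ Finset.range j, x i := mul_le_mul_of_nonneg_right h1 h2
      _ = _ := by ring

/-- Each floor loses at most `1`; the loss at the step using `x k` is then multiplied by the later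
factors `x 0, …, x (k - 1)`. -/
lemma le_revLabel (hx : ∀ i, 0 ≤ x i) (n j : ℕ) :
    (n : ℝ) * ∏ i ∈ Finset.range j, x i ≤
      revLabel x n j + ∑ k ∈ Finset.range j, ∏ i ∈ Finset.range k, x i := by
  induction j generalizing n with
  | zero => simp [revLabel]
  | succ j ih =>
    rw [revLabel, Finset.prod_range_succ, Finset.sum_range_succ]
    have h1 : (n : ℝ) * x j ≤ ⌊(n : ℝ) * x j⌋₊ + 1 := (Nat.lt_floor_add_one _).le
    have h2 : 0 ≤ ∏ i ∈ Finset.range j, x i := Finset.prod_nonneg fun i _ => hx i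
    have h3 := mul_le_mul_of_nonneg_right h1 h2
    have h4 := ih ⌊(n : ℝ) * x j⌋₊
    linarith

lemma label_const (r : ℝ) (n j : ℕ) : label (fun _ => r) n j = revLabel (fun _ => r) n j := by
  induction j generalizing n with
  | zero => rfl
  | succ j ih =>
    rw [label_succ_eq_label_parent, ih]
    rfl

lemma measurable_parent (i : ℕ) : Measurable fun x : ℕ → ℝ => parent x i := by
  have hi : Measurable fun x : ℕ → ℝ => (i : ℝ) * x i := (measurable_pi_apply i).const_mul _
  exact Nat.measurable_floor.comp hi

lemma measurable_label (n j : ℕ) : Measurable fun x : ℕ → ℝ => label x n j := by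
  induction j with
  | zero => exact measurable_const
  | succ j ih =>
    have h : Measurable fun p : ℕ × (ℕ → ℝ) => parent p.2 p.1 :=
      measurable_from_prod_countable_right measurable_parent
    have h' : Measurable fun x : ℕ → ℝ => (label x n j, x) := ih.prodMk measurable_id
    have h'' := h.comp h'
    simpa only [Function.comp_def, label] using h''

lemma measurable_revLabel (n j : ℕ) : Measurable fun x : ℕ → ℝ => revLabel x n j := by
  induction j generalizing n with
  | zero => exact measurable_const
  | succ j ih =>
    have h : Measurable fun p : ℕ × (ℕ → ℝ) => revLabel p.2 p.1 j :=
      measurable_from_prod_countable_right fun i => ih i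
    exact h.comp ((Nat.measurable_floor.comp
      ((measurable_pi_apply j).const_mul _)).prodMk measurable_id)

end Deterministic

/-! ### Equality in law of the walk and the reversed walk at the root. -/

section Law

variable {Ω : Type*} [MeasurableSpace Ω] {P : Measure Ω} {ν : Measure ℝ} {X : ℕ → Ω → ℝ}

lemma measurable_depth (hX : IsAttachmentSequence P ν X) (n : ℕ) :
    Measurable fun ω => depth (fun i => X i ω) n := by
  refine measurable_of_Iic fun j => ?_
  have : (fun ω => depth (fun i => X i ω) n) ⁻¹' Set.Iic j =
      (fun ω => label (fun i => X i ω) n j) ⁻¹' {0} := by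
    ext ω
    exact depth_le_iff fun i => hX.mem_Ico i ω
  rw [this]
  exact (measurable_label n j).comp (measurable_pi_lambda _ hX.measurable)
    (measurableSet_singleton 0)

/-- A functional of finitely many of the variables is independent of any other variable. -/
lemma indepFun_of_dependsOn [IsProbabilityMeasure P] (hX : IsAttachmentSequence P ν X)
    {f : (ℕ → ℝ) → ℕ} (hf : Measurable f) {g : ℝ → ℕ} (hg : Measurable g) {S : Finset ℕ} {k : ℕ}
    (hk : k ∉ S) (hS : ∀ x y : ℕ → ℝ, (∀ i, x i ∈ Set.Ico (0 : ℝ) 1) → (∀ i ∈ S, x i = y i) →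
      f x = f y) :
    IndepFun (fun ω => g (X k ω)) (fun ω => f fun i => X i ω) P := by
  have h := hX.indep.indepFun_finset {k} S (by simpa using hk) hX.measurable
  -- Extension by zero turns `f` into a function of the coordinates in `S` alone; by `hS` it agrees
  -- with `f` on the actual sequence.
  let e : (S → ℝ) → ℕ → ℝ := fun z i => if h : i ∈ S then z ⟨i, h⟩ else 0
  have he : Measurable e := by
    refine measurable_pi_lambda _ fun i => ?_
    by_cases h : i ∈ S
    · simpa [e, h] using measurable_pi_apply _
    · simp [e, h]
  have hgk : Measurable fun z : ({k} : Finset ℕ) → ℝ => g (z ⟨k, by simp⟩) :=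
    hg.comp (measurable_pi_apply _)
  have h' := h.comp hgk (hf.comp he)
  have h2 : (fun ω => f fun i => X i ω) =
      (fun z => f (e z)) ∘ fun ω (i : S) => X i ω := by
    funext ω
    refine hS _ _ (fun i => hX.mem_Ico i ω) fun i hi => ?_
    simp [e, hi]
  rw [h2]
  exact h'

/-- Decomposition of the event that the walk is at the root according to the first step. -/
lemma measure_step [IsProbabilityMeasure P] (hX : IsAttachmentSequence P ν X)
    {f : ℕ → (ℕ → ℝ) → ℕ} (hf : ∀ k, Measurable (f k)) {n l : ℕ} {S : Finset ℕ} (hn : n ≠ 0)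
    (hl : l ∉ S) (hS : ∀ k < n, ∀ x y : ℕ → ℝ, (∀ i, x i ∈ Set.Ico (0 : ℝ) 1) →
      (∀ i ∈ S, x i = y i) → f k x = f k y) :
    P {ω | f ⌊(n : ℝ) * X l ω⌋₊ (fun i => X i ω) = 0} =
      ∑ k ∈ Finset.range n, ν {x | ⌊(n : ℝ) * x⌋₊ = k} * P {ω | f k (fun i => X i ω) = 0} := by
  have hfl : Measurable fun x : ℝ => ⌊(n : ℝ) * x⌋₊ :=
    Nat.measurable_floor.comp (measurable_id.const_mul _)
  have hXm : Measurable fun ω => fun i => X i ω := measurable_pi_lambda _ hX.measurable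
  have hset : {ω | f ⌊(n : ℝ) * X l ω⌋₊ (fun i => X i ω) = 0} =
      ⋃ k ∈ Finset.range n,
        ((fun ω => ⌊(n : ℝ) * X l ω⌋₊) ⁻¹' {k} ∩ (fun ω => f k fun i => X i ω) ⁻¹' {0}) := by
    ext ω
    have hlt : ⌊(n : ℝ) * X l ω⌋₊ < n := by
      rw [Nat.floor_lt (mul_nonneg (Nat.cast_nonneg n) (hX.mem_Ico l ω).1)]
      have : (0 : ℝ) < n := by positivity
      nlinarith [(hX.mem_Ico l ω).2]
    simp [hlt]
  rw [hset, measure_biUnion_finset]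
  · refine Finset.sum_congr rfl fun k hk => ?_
    rw [(indepFun_of_dependsOn hX (hf k) hfl hl (hS k (Finset.mem_range.1 hk))
      ).measure_inter_preimage_eq_mul _ _ (measurableSet_singleton k) (measurableSet_singleton 0)]
    congr 1
    rw [← hX.law l]
    exact (Measure.map_apply (hX.measurable l) (hfl (measurableSet_singleton k))).symm
  · intro a _ b _ hab
    refine Set.disjoint_left.2 fun ω ha hb => hab ?_
    exact ha.1.symm.trans hb.1
  · intro k _
    exact ((hfl.comp (hX.measurable l)) (measurableSet_singleton k)).inter
      (((hf k).comp hXm) (measurableSet_singleton 0))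

/-- Both walks leave `n` by a step of the same law. What follows is independent of that step: the
walk at `k < n` only uses indices below `n`, the reversed walk only indices below `j`. Hence both
probabilities satisfy the same recursion. -/
lemma measure_label_eq_zero [IsProbabilityMeasure P] (hX : IsAttachmentSequence P ν X)
    (n j : ℕ) :
    P {ω | label (fun i => X i ω) n j = 0} = P {ω | revLabel (fun i => X i ω) n j = 0} := by
  induction j generalizing n with
  | zero => rfl
  | succ j ih =>
    rcases eq_or_ne n 0 with rfl | hn
    · simp [revLabel_zero_left]
    · have h1 := measure_step hX (f := fun k x => label x k j) (fun k => measurable_label k j)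
        (l := n) (S := Finset.range n) hn (by simp)
        (fun k hk x y hx hxy => label_congr hx (fun i hi =>
          hxy i (Finset.mem_range.2 (lt_of_le_of_lt hi hk))) j)
      have h2 := measure_step hX (f := fun k x => revLabel x k j)
        (fun k => measurable_revLabel k j) (l := j) (S := Finset.range j) hn (by simp)
        (fun k _ x y _ hxy => revLabel_congr (fun i hi => hxy i (Finset.mem_range.2 hi)) k)
      simp only [label_succ_eq_label_parent, parent, revLabel]
      rw [h1, h2]
      exact Finset.sum_congr rfl fun k _ => by rw [ih]

lemma measure_depth_le [IsProbabilityMeasure P] (hX : IsAttachmentSequence P ν X) (n j : ℕ) :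
    P {ω | depth (fun i => X i ω) n ≤ j} = P {ω | revLabel (fun i => X i ω) n j = 0} := by
  rw [← measure_label_eq_zero hX]
  congr 1
  ext ω
  exact depth_le_iff fun i => hX.mem_Ico i ω

end Law

/-! ### Tail bounds for the depth through sums of logarithms. -/

section Tails

variable {Ω : Type*} [MeasurableSpace Ω] {P : Measure Ω} {ν : Measure ℝ} {X : ℕ → Ω → ℝ}

lemma IsAttachmentSequence.isProbabilityMeasure [IsProbabilityMeasure P]
    (hX : IsAttachmentSequence P ν X) : IsProbabilityMeasure ν := by
  rw [← hX.law 0]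
  exact Measure.isProbabilityMeasure_map (hX.measurable 0).aemeasurable

lemma IsAttachmentSequence.ae_mem_Ico (hX : IsAttachmentSequence P ν X) :
    ∀ᵐ x ∂ν, x ∈ Set.Ico (0 : ℝ) 1 := by
  rw [← hX.law 0]
  exact (ae_map_iff (hX.measurable 0).aemeasurable measurableSet_Ico).2
    (Eventually.of_forall fun ω => hX.mem_Ico 0 ω)

lemma IsAttachmentSequence.ae_of_ae (hX : IsAttachmentSequence P ν X) {p : ℝ → Prop}
    (hp : ∀ᵐ x ∂ν, p x) : ∀ᵐ ω ∂P, ∀ i, p (X i ω) := by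
  refine ae_all_iff.2 fun i => ?_
  rw [← hX.law i] at hp
  exact ae_of_ae_map (hX.measurable i).aemeasurable hp

lemma IsAttachmentSequence.integral_comp (hX : IsAttachmentSequence P ν X) {g : ℝ → ℝ}
    (hg : Measurable g) (i : ℕ) : ∫ ω, g (X i ω) ∂P = ∫ x, g x ∂ν := by
  rw [← hX.law i, integral_map (hX.measurable i).aemeasurable hg.aestronglyMeasurable]

lemma IsAttachmentSequence.identDistrib (hX : IsAttachmentSequence P ν X) {g : ℝ → ℝ}
    (hg : Measurable g) (i : ℕ) :
    IdentDistrib (fun ω => g (X i ω)) (fun ω => g (X 0 ω)) P P :=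
  IdentDistrib.comp (u := g) ⟨(hX.measurable i).aemeasurable, (hX.measurable 0).aemeasurable,
    (hX.law i).trans (hX.law 0).symm⟩ hg

lemma IsAttachmentSequence.integrable_comp (hX : IsAttachmentSequence P ν X) {g : ℝ → ℝ}
    (hg : Integrable g ν) (i : ℕ) : Integrable (fun ω => g (X i ω)) P := by
  rw [← hX.law i] at hg
  exact hg.comp_measurable (hX.measurable i)

lemma IsAttachmentSequence.integrable_id [IsProbabilityMeasure P]
    (hX : IsAttachmentSequence P ν X) : Integrable (fun x : ℝ => x) ν := by
  have := hX.isProbabilityMeasure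
  refine Integrable.of_mem_Icc 0 1 measurable_id.aemeasurable ?_
  filter_upwards [hX.ae_mem_Ico] with x hx
  exact ⟨hx.1, hx.2.le⟩

lemma IsAttachmentSequence.integral_id_nonneg (hX : IsAttachmentSequence P ν X) :
    0 ≤ ∫ x, x ∂ν :=
  integral_nonneg_of_ae (by filter_upwards [hX.ae_mem_Ico] with x hx using hx.1)

lemma IsAttachmentSequence.integral_id_lt_one [IsProbabilityMeasure P]
    (hX : IsAttachmentSequence P ν X) : ∫ x, x ∂ν < 1 := by
  have := hX.isProbabilityMeasure
  have h : 0 < ∫ x, (1 - x) ∂ν := by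
    rw [integral_pos_iff_support_of_nonneg_ae]
    · have : ν (Function.support fun x : ℝ => 1 - x) = 1 := by
        rw [prob_compl_eq_zero_iff₀ ?_ |>.symm]
        · rw [← mem_ae_iff]
          filter_upwards [hX.ae_mem_Ico] with x hx
          simpa [sub_eq_zero] using hx.2.ne'
        · exact ((measurable_const.sub measurable_id).nullMeasurable (measurableSet_singleton 0).compl)
      rw [this]
      exact one_pos
    · filter_upwards [hX.ae_mem_Ico] with x hx
      simpa using hx.2.le
    · exact (integrable_const 1).sub hX.integrable_id
  rw [integral_sub (integrable_const 1) hX.integrable_id] at h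
  simpa using h

lemma prod_mem_Icc (hX : IsAttachmentSequence P ν X) (j : ℕ) (ω : Ω) :
    ∏ i ∈ Finset.range j, X i ω ∈ Set.Icc (0 : ℝ) 1 :=
  ⟨Finset.prod_nonneg fun i _ => (hX.mem_Ico i ω).1,
    Finset.prod_le_one (fun i _ => (hX.mem_Ico i ω).1) fun i _ => (hX.mem_Ico i ω).2.le⟩

lemma integrable_prod [IsProbabilityMeasure P] (hX : IsAttachmentSequence P ν X) (j : ℕ) :
    Integrable (fun ω => ∏ i ∈ Finset.range j, X i ω) P :=
  Integrable.of_mem_Icc 0 1 (Finset.measurable_prod _ fun i _ => hX.measurable i).aemeasurable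
    (Eventually.of_forall fun ω => prod_mem_Icc hX j ω)

lemma integral_prod_range [IsProbabilityMeasure P] (hX : IsAttachmentSequence P ν X) (j : ℕ) :
    ∫ ω, ∏ i ∈ Finset.range j, X i ω ∂P = (∫ x, x ∂ν) ^ j := by
  induction j with
  | zero => simp
  | succ j ih =>
    have hind : IndepFun (fun ω => ∏ i ∈ Finset.range j, X i ω) (X j) P := by
      have := hX.indep.indepFun_prod_range_succ hX.measurable j
      convert! this using 1
      ext ω
      simp
    simp only [Finset.prod_range_succ]
    rw [hind.integral_fun_mul_eq_mul_integral (integrable_prod hX j).aestronglyMeasurable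
      (hX.measurable j).aestronglyMeasurable, ih, pow_succ]
    congr 1
    exact hX.integral_comp measurable_id j

lemma measureReal_depth_le [IsProbabilityMeasure P] (hX : IsAttachmentSequence P ν X) (n j : ℕ) :
    P.real {ω | depth (fun i => X i ω) n ≤ j} =
      P.real {ω | revLabel (fun i => X i ω) n j = 0} := by
  rw [measureReal_def, measureReal_def, measure_depth_le hX]

lemma measureReal_lt_depth [IsProbabilityMeasure P] (hX : IsAttachmentSequence P ν X) (n j : ℕ) :
    P.real {ω | j < depth (fun i => X i ω) n} =
      P.real {ω | revLabel (fun i => X i ω) n j ≠ 0} := by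
  have h1 : {ω | j < depth (fun i => X i ω) n} = {ω | depth (fun i => X i ω) n ≤ j}ᶜ := by
    ext ω
    simp
  have h2 : {ω | revLabel (fun i => X i ω) n j ≠ 0} =
      {ω | revLabel (fun i => X i ω) n j = 0}ᶜ := rfl
  rw [h1, h2, probReal_compl_eq_one_sub, probReal_compl_eq_one_sub, measureReal_depth_le hX]
  · exact (measurable_revLabel n j).comp (measurable_pi_lambda _ hX.measurable)
      (measurableSet_singleton 0)
  · exact measurable_depth hX n measurableSet_Iic

/-- Markov's inequality for `n ∏ X i`, which is at least `1` while the integer `revLabel` is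
nonzero. -/
lemma measureReal_lt_depth_le_pow [IsProbabilityMeasure P] (hX : IsAttachmentSequence P ν X)
    (n j : ℕ) : P.real {ω | j < depth (fun i => X i ω) n} ≤ n * (∫ x, x ∂ν) ^ j := by
  rw [measureReal_lt_depth hX]
  have h := mul_meas_ge_le_integral_of_nonneg (μ := P)
    (f := fun ω => (n : ℝ) * ∏ i ∈ Finset.range j, X i ω)
    (Eventually.of_forall fun ω => mul_nonneg (Nat.cast_nonneg n) (prod_mem_Icc hX j ω).1)
    ((integrable_prod hX j).const_mul _) 1
  rw [integral_const_mul, integral_prod_range hX, one_mul] at h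
  refine le_trans (measureReal_mono fun ω hω => ?_) h
  have h1 : (1 : ℝ) ≤ revLabel (fun i => X i ω) n j := by
    exact_mod_cast Nat.one_le_iff_ne_zero.2 hω
  exact h1.trans (revLabel_le (fun i => (hX.mem_Ico i ω).1) n j)

/-- A general majorant `g` of the logarithm covers both `Real.log` and its truncations, the latter
being needed when `log X` is not integrable. -/
lemma measureReal_lt_depth_le_sum [IsProbabilityMeasure P] (hX : IsAttachmentSequence P ν X)
    {g : ℝ → ℝ} (hg : ∀ x ∈ Set.Ico (0 : ℝ) 1, x ≤ Real.exp (g x)) (n j : ℕ) :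
    P.real {ω | j < depth (fun i => X i ω) n} ≤
      P.real {ω | -Real.log n ≤ ∑ i ∈ Finset.range j, g (X i ω)} := by
  rw [measureReal_lt_depth hX]
  refine measureReal_mono fun ω hω => ?_
  have h1 : (1 : ℝ) ≤ revLabel (fun i => X i ω) n j := by
    exact_mod_cast Nat.one_le_iff_ne_zero.2 hω
  have hn : n ≠ 0 := by
    rintro rfl
    exact hω (revLabel_zero_left _ _)
  have hn' : (0 : ℝ) < n := by positivity
  have h2 := h1.trans (revLabel_le (fun i => (hX.mem_Ico i ω).1) n j)
  have h3 : ∏ i ∈ Finset.range j, X i ω ≤ Real.exp (∑ i ∈ Finset.range j, g (X i ω)) := by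
    rw [Real.exp_sum]
    exact Finset.prod_le_prod (fun i _ => (hX.mem_Ico i ω).1) fun i _ => hg _ (hX.mem_Ico i ω)
  have h4 : (n : ℝ)⁻¹ ≤ Real.exp (∑ i ∈ Finset.range j, g (X i ω)) := by
    refine le_trans ?_ h3
    rwa [inv_le_iff_one_le_mul₀' hn']
  have h5 := Real.log_le_log (by positivity) h4
  rwa [Real.log_exp, Real.log_inv] at h5

/-- Markov's inequality and a geometric series, so that the bound is uniform in `j`. -/
lemma measureReal_le_sum_prod [IsProbabilityMeasure P] (hX : IsAttachmentSequence P ν X)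
    {K : ℝ} (hK : 0 < K) (j : ℕ) :
    P.real {ω | K ≤ ∑ k ∈ Finset.range j, ∏ i ∈ Finset.range k, X i ω} ≤
      (1 - ∫ x, x ∂ν)⁻¹ / K := by
  have h := mul_meas_ge_le_integral_of_nonneg (μ := P)
    (f := fun ω => ∑ k ∈ Finset.range j, ∏ i ∈ Finset.range k, X i ω)
    (Eventually.of_forall fun ω => Finset.sum_nonneg fun k _ => (prod_mem_Icc hX k ω).1)
    (integrable_finsetSum _ fun k _ => integrable_prod hX k) K
  rw [integral_finsetSum _ fun k _ => integrable_prod hX k] at h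
  simp only [integral_prod_range hX] at h
  rw [le_div_iff₀' hK]
  refine h.trans ?_
  rw [← tsum_geometric_of_lt_one hX.integral_id_nonneg hX.integral_id_lt_one]
  exact (summable_geometric_of_lt_one hX.integral_id_nonneg hX.integral_id_lt_one).sum_le_tsum _
    fun i _ => pow_nonneg hX.integral_id_nonneg i

/-- If `revLabel` vanishes and the rounding error is below `K`, then `n ∏ X i ≤ K`. Zeros of `X`
must be excluded because `Real.log 0 = 0` would not record them. -/
lemma measureReal_depth_le_sum [IsProbabilityMeasure P] (hX : IsAttachmentSequence P ν X)
    (h0 : ∀ᵐ x ∂ν, x ≠ 0) {n : ℕ} (hn : n ≠ 0) {K : ℝ} (hK : 0 < K) (j : ℕ) :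
    P.real {ω | depth (fun i => X i ω) n ≤ j} ≤
      P.real {ω | ∑ i ∈ Finset.range j, Real.log (X i ω) ≤ Real.log K - Real.log n} +
        (1 - ∫ x, x ∂ν)⁻¹ / K := by
  rw [measureReal_depth_le hX]
  refine le_trans ?_ (add_le_add_right (measureReal_le_sum_prod hX hK j) _)
  refine le_trans ?_ (measureReal_union_le _ _)
  refine ENNReal.toReal_mono (measure_ne_top _ _) (measure_mono_ae ?_)
  filter_upwards [hX.ae_of_ae h0] with ω hω hR
  have hpos : ∀ i, 0 < X i ω := fun i => lt_of_le_of_ne (hX.mem_Ico i ω).1 (hω i).symm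
  rcases le_or_gt K (∑ k ∈ Finset.range j, ∏ i ∈ Finset.range k, X i ω) with h | h
  · exact Or.inr h
  · left
    have h1 := le_revLabel (fun i => (hpos i).le) n j
    have hR' : revLabel (fun i => X i ω) n j = 0 := hR
    rw [hR', Nat.cast_zero, zero_add] at h1
    have hn' : (0 : ℝ) < n := by positivity
    have hp : 0 < ∏ i ∈ Finset.range j, X i ω := Finset.prod_pos fun i _ => hpos i
    have h2 := Real.log_le_log (mul_pos hn' hp) (h1.trans h.le)
    rw [Real.log_mul hn'.ne' hp.ne', Real.log_prod fun i _ => (hpos i).ne'] at h2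
    show ∑ i ∈ Finset.range j, Real.log (X i ω) ≤ Real.log K - Real.log n
    linarith

end Tails

/-! ### Law of large numbers for the depth, and convergence of expectations. -/

section Convergence

variable {Ω : Type*} [MeasurableSpace Ω] {P : Measure Ω} {ν : Measure ℝ} {X : ℕ → Ω → ℝ}

lemma tendsto_measureReal_le_sum [IsProbabilityMeasure P] (hX : IsAttachmentSequence P ν X)
    {g : ℝ → ℝ} (hg : Measurable g) (hgi : Integrable g ν) {a : ℝ} (ha : ∫ x, g x ∂ν < a) :
    Tendsto (fun j : ℕ => P.real {ω | a * j ≤ ∑ i ∈ Finset.range j, g (X i ω)}) atTop (𝓝 0) := by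
  have hslln := strong_law_ae_real (μ := P) (fun i ω => g (X i ω)) (hX.integrable_comp hgi 0)
    (fun i k hik => (hX.indep.indepFun hik).comp hg hg) (hX.identDistrib hg)
  have hm := tendstoInMeasure_of_tendsto_ae (fun j => ((Finset.measurable_fun_sum
    (Finset.range j) fun i _ => hg.comp (hX.measurable i)).div_const
      (j : ℝ)).aestronglyMeasurable) hslln
  rw [tendstoInMeasure_iff_measureReal_dist] at hm
  have hm' := hm (a - ∫ x, g x ∂ν) (sub_pos.2 ha)
  refine tendsto_of_tendsto_of_tendsto_of_le_of_le' tendsto_const_nhds hm'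
    (Eventually.of_forall fun _ => measureReal_nonneg) ?_
  filter_upwards [eventually_gt_atTop 0] with j hj
  refine measureReal_mono fun ω hω => ?_
  have hj' : (0 : ℝ) < j := by exact_mod_cast hj
  have h1 : a ≤ (∑ i ∈ Finset.range j, g (X i ω)) / j := (le_div_iff₀ hj').2 hω
  simp only [Set.mem_ofPred_eq, hX.integral_comp hg, Real.dist_eq, Function.comp_apply]
  exact le_trans (by linarith) (le_abs_self _)

lemma tendsto_measureReal_sum_le [IsProbabilityMeasure P] (hX : IsAttachmentSequence P ν X)
    {g : ℝ → ℝ} (hg : Measurable g) (hgi : Integrable g ν) {a : ℝ} (ha : a < ∫ x, g x ∂ν) :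
    Tendsto (fun j : ℕ => P.real {ω | ∑ i ∈ Finset.range j, g (X i ω) ≤ a * j}) atTop (𝓝 0) := by
  have h := tendsto_measureReal_le_sum hX hg.neg hgi.neg (a := -a)
    (by simpa [integral_neg] using ha)
  simpa using h

lemma tendsto_log_natCast_atTop : Tendsto (fun n : ℕ => Real.log n) atTop atTop :=
  Real.tendsto_log_atTop.comp tendsto_natCast_atTop_atTop

/-- Upper tail of the depth, from an integrable majorant of the logarithm. -/
lemma tendsto_measureReal_lt_depth [IsProbabilityMeasure P] (hX : IsAttachmentSequence P ν X)
    {g : ℝ → ℝ} (hg : Measurable g) (hgi : Integrable g ν)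
    (hexp : ∀ x ∈ Set.Ico (0 : ℝ) 1, x ≤ Real.exp (g x)) {b : ℝ} (hb : 0 < b)
    (hgb : ∫ x, g x ∂ν < -b⁻¹) :
    Tendsto (fun n : ℕ => P.real {ω | b * Real.log n < depth (fun i => X i ω) n})
      atTop (𝓝 0) := by
  obtain ⟨a, ha1, ha2⟩ := exists_between hgb
  have hba : 1 < b * -a := by
    have := mul_lt_mul_of_pos_left (lt_neg_of_lt_neg ha2) hb
    rwa [mul_inv_cancel₀ hb.ne'] at this
  have ha0 : 0 < -a := by
    have : 0 < b⁻¹ := inv_pos.2 hb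
    linarith
  have hj : Tendsto (fun n : ℕ => ⌊b * Real.log n⌋₊) atTop atTop :=
    tendsto_nat_floor_atTop.comp (tendsto_log_natCast_atTop.const_mul_atTop hb)
  refine tendsto_of_tendsto_of_tendsto_of_le_of_le' tendsto_const_nhds
    ((tendsto_measureReal_le_sum hX hg hgi ha1).comp hj)
    (Eventually.of_forall fun _ => measureReal_nonneg) ?_
  -- Beyond this threshold `a * j ≤ -log n` holds for `j = ⌊b log n⌋` despite the unit lost in the
  -- floor.
  filter_upwards [tendsto_log_natCast_atTop.eventually_ge_atTop (-a / (b * -a - 1))] with n hn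
  have hn' : -a ≤ Real.log n * (b * -a - 1) := (div_le_iff₀ (by linarith)).1 hn
  have hfl := Nat.lt_floor_add_one (b * Real.log n)
  have hlog : 0 ≤ Real.log n := Real.log_natCast_nonneg n
  calc P.real {ω | b * Real.log n < depth (fun i => X i ω) n}
      ≤ P.real {ω | ⌊b * Real.log n⌋₊ < depth (fun i => X i ω) n} := by
        refine measureReal_mono fun ω hω => ?_
        exact (Nat.floor_lt (mul_nonneg hb.le hlog)).2 hω
    _ ≤ _ := measureReal_lt_depth_le_sum hX hexp n _
    _ ≤ _ := by
        refine measureReal_mono fun ω hω => ?_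
        have h1 : -Real.log n ≤ ∑ i ∈ Finset.range ⌊b * Real.log n⌋₊, g (X i ω) := hω
        refine le_trans ?_ h1
        have := mul_lt_mul_of_pos_left hfl ha0
        nlinarith

/-- Lets `n → ∞` with `K` fixed, and only then `K → ∞`. -/
lemma tendsto_zero_of_le_add_const_div {u : ℕ → ℝ} (hu : ∀ n, 0 ≤ u n) {C : ℝ} (hC : 0 ≤ C)
    (h : ∀ K > 0, ∃ v : ℕ → ℝ, Tendsto v atTop (𝓝 0) ∧ ∀ᶠ n in atTop, u n ≤ v n + C / K) :
    Tendsto u atTop (𝓝 0) := by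
  refine tendsto_order.2 ⟨fun a ha => Eventually.of_forall fun n => ha.trans_le (hu n),
    fun a ha => ?_⟩
  obtain ⟨v, hv, huv⟩ := h ((2 * (C + 1)) / a) (by positivity)
  have hlt : C / ((2 * (C + 1)) / a) < a / 2 := by
    rw [div_div_eq_mul_div, div_lt_div_iff₀ (by positivity) two_pos]
    nlinarith
  filter_upwards [huv, hv.eventually_lt_const (half_pos ha)] with n h1 h2
  linarith

lemma tendsto_measureReal_depth_le [IsProbabilityMeasure P] (hX : IsAttachmentSequence P ν X)
    (h0 : ∀ᵐ x ∂ν, x ≠ 0) (hi : Integrable Real.log ν) {b : ℝ} (hb : 0 < b)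
    (hlog : -b⁻¹ < ∫ x, Real.log x ∂ν) :
    Tendsto (fun n : ℕ => P.real {ω | (depth (fun i => X i ω) n : ℝ) ≤ b * Real.log n})
      atTop (𝓝 0) := by
  -- Negativity of `a` gives `a * ⌊b log n⌋ ≥ a * b * log n`.
  obtain ⟨a, ha1, ha2, ha0⟩ : ∃ a, -b⁻¹ < a ∧ a < ∫ x, Real.log x ∂ν ∧ a < 0 := by
    have : -b⁻¹ < 0 := neg_neg_of_pos (inv_pos.2 hb)
    obtain ⟨a, ha1, ha2⟩ := exists_between (lt_min hlog this)
    exact ⟨a, ha1, ha2.trans_le (min_le_left _ _), ha2.trans_le (min_le_right _ _)⟩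
  have hba : 0 < 1 + a * b := by
    have := mul_lt_mul_of_pos_right ha1 hb
    rw [neg_mul, inv_mul_cancel₀ hb.ne'] at this
    linarith
  have hj : Tendsto (fun n : ℕ => ⌊b * Real.log n⌋₊) atTop atTop :=
    tendsto_nat_floor_atTop.comp (tendsto_log_natCast_atTop.const_mul_atTop hb)
  refine tendsto_zero_of_le_add_const_div (fun _ => measureReal_nonneg)
    (inv_nonneg.2 (sub_nonneg.2 hX.integral_id_lt_one.le)) fun K hK => ⟨_,
      (tendsto_measureReal_sum_le hX Real.measurable_log hi ha2).comp hj, ?_⟩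
  filter_upwards [tendsto_log_natCast_atTop.eventually_ge_atTop (Real.log K / (1 + a * b)),
    eventually_ne_atTop 0] with n hn hn0
  have hn' : Real.log K ≤ Real.log n * (1 + a * b) := (div_le_iff₀ hba).1 hn
  have hlogn : 0 ≤ Real.log n := Real.log_natCast_nonneg n
  have hfl := Nat.floor_le (mul_nonneg hb.le hlogn)
  calc P.real {ω | (depth (fun i => X i ω) n : ℝ) ≤ b * Real.log n}
      ≤ P.real {ω | depth (fun i => X i ω) n ≤ ⌊b * Real.log n⌋₊} := by
        refine measureReal_mono fun ω hω => ?_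
        exact Nat.le_floor hω
    _ ≤ _ := measureReal_depth_le_sum hX h0 hn0 hK _
    _ ≤ _ := by
        gcongr
        refine measureReal_mono fun ω hω => ?_
        have h1 : ∑ i ∈ Finset.range ⌊b * Real.log n⌋₊, Real.log (X i ω) ≤
          Real.log K - Real.log n := hω
        refine h1.trans ?_
        nlinarith

lemma integrable_depth [IsProbabilityMeasure P] (hX : IsAttachmentSequence P ν X) (n : ℕ) :
    Integrable (fun ω => (depth (fun i => X i ω) n : ℝ)) P := by
  refine Integrable.of_mem_Icc 0 n (measurable_from_nat.comp (measurable_depth hX n)).aemeasurable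
    (Eventually.of_forall fun ω => ⟨Nat.cast_nonneg _, ?_⟩)
  exact_mod_cast depth_le_self (fun i => hX.mem_Ico i ω) n

/-- The part of the depth above a suitable multiple of `log n` has bounded expectation. -/
lemma exists_integral_depth_excess_le [IsProbabilityMeasure P]
    (hX : IsAttachmentSequence P ν X) :
    ∃ A C : ℝ, 0 ≤ A ∧ ∀ n ≠ 0,
      ∫ ω, max ((depth (fun i => X i ω) n : ℝ) - A * Real.log n) 0 ∂P ≤ C := by
  -- The maximum with `1 / 2` keeps `log q` meaningful when `E X = 0`.
  set q : ℝ := max (∫ x, x ∂ν) (1 / 2) with hq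
  have hq0 : 0 < q := lt_max_of_lt_right (by norm_num)
  have hq1 : q < 1 := max_lt hX.integral_id_lt_one (by norm_num)
  have hlq : Real.log q < 0 := Real.log_neg hq0 hq1
  refine ⟨(-Real.log q)⁻¹, 1 + (1 - q)⁻¹, by rw [inv_nonneg]; linarith, fun n hn => ?_⟩
  have hn' : (0 : ℝ) < n := by positivity
  set t : ℝ := (-Real.log q)⁻¹ * Real.log n with ht
  have ht0 : 0 ≤ t := mul_nonneg (by rw [inv_nonneg]; linarith) (Real.log_natCast_nonneg n)
  -- With this `N`, `n * q ^ N ≤ 1`, so `P (D n > N + k) ≤ q ^ k`.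
  set N : ℕ := ⌈t⌉₊ with hN
  have hqN : n * q ^ N ≤ 1 := by
    have h1 : q ^ N ≤ q ^ t := by
      rw [← Real.rpow_natCast]
      exact Real.rpow_le_rpow_of_exponent_ge hq0 hq1.le (Nat.le_ceil t)
    have h2 : q ^ t = (n : ℝ)⁻¹ := by
      rw [Real.rpow_def_of_pos hq0, ← Real.exp_log (inv_pos.2 hn'), Real.log_inv, ht]
      congr 1
      have hlq' := hlq.ne
      field_simp
    rw [h2] at h1
    calc n * q ^ N ≤ n * (n : ℝ)⁻¹ := by gcongr
      _ = 1 := mul_inv_cancel₀ hn'.ne'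
  have hset : ∀ k, MeasurableSet {ω | N + k < depth (fun i => X i ω) n} := fun k =>
    measurable_depth hX n measurableSet_Ioi
  -- The sum counts the units of depth above `N`; `k < n` suffices since the depth is at most `n`,
  -- and the `1` pays for the ceiling in `N`.
  have hpt : ∀ ω, max ((depth (fun i => X i ω) n : ℝ) - t) 0 ≤
      1 + ∑ k ∈ Finset.range n,
        {ω | N + k < depth (fun i => X i ω) n}.indicator (1 : Ω → ℝ) ω := by
    intro ω
    set d := depth (fun i => X i ω) n with hd
    have hdn : d ≤ n := depth_le_self (fun i => hX.mem_Ico i ω) n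
    have h1 : ∑ k ∈ Finset.range n,
        {ω | N + k < depth (fun i => X i ω) n}.indicator (1 : Ω → ℝ) ω =
        ((Finset.range n).filter fun k => N + k < d).card := by
      simp [Set.indicator_apply, ← hd]
    have h2 : d - N ≤ ((Finset.range n).filter fun k => N + k < d).card := by
      rw [← Finset.card_range (d - N)]
      refine Finset.card_le_card fun k hk => ?_
      simp only [Finset.mem_range, Finset.mem_filter] at hk ⊢
      omega
    have h3 : (d : ℝ) - N ≤ ((Finset.range n).filter fun k => N + k < d).card := by
      have : d ≤ ((Finset.range n).filter fun k => N + k < d).card + N := by omega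
      have : (d : ℝ) ≤ ((Finset.range n).filter fun k => N + k < d).card + N := by
        exact_mod_cast this
      linarith
    have h4 := Nat.ceil_lt_add_one ht0
    rw [h1]
    refine max_le (by linarith) (by positivity)
  have hind : ∀ k, Integrable
      ({ω | N + k < depth (fun i => X i ω) n}.indicator (1 : Ω → ℝ)) P := fun k =>
    (integrable_const 1).indicator (hset k)
  calc ∫ ω, max ((depth (fun i => X i ω) n : ℝ) - t) 0 ∂P
      ≤ ∫ ω, (1 + ∑ k ∈ Finset.range n,
        {ω | N + k < depth (fun i => X i ω) n}.indicator (1 : Ω → ℝ) ω) ∂P :=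
        integral_mono (((integrable_depth hX n).sub (integrable_const t)).pos_part)
          ((integrable_const 1).add (integrable_finsetSum _ fun k _ => hind k)) hpt
    _ = 1 + ∑ k ∈ Finset.range n, P.real {ω | N + k < depth (fun i => X i ω) n} := by
        rw [integral_add (integrable_const 1) (integrable_finsetSum _ fun k _ => hind k),
          integral_finsetSum _ fun k _ => hind k]
        simp [integral_indicator_one (hset _)]
    _ ≤ 1 + ∑ k ∈ Finset.range n, q ^ k := by
        gcongr with k _
        refine (measureReal_lt_depth_le_pow hX n (N + k)).trans ?_
        calc (n : ℝ) * (∫ x, x ∂ν) ^ (N + k) ≤ n * q ^ (N + k) := by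
              have h0 := hX.integral_id_nonneg
              gcongr
              exact le_max_left _ _
          _ = (n * q ^ N) * q ^ k := by rw [pow_add, mul_assoc]
          _ ≤ 1 * q ^ k := by gcongr
          _ = q ^ k := one_mul _
    _ ≤ 1 + (1 - q)⁻¹ := by
        gcongr
        rw [← tsum_geometric_of_lt_one hq0.le hq1]
        exact (summable_geometric_of_lt_one hq0.le hq1).sum_le_tsum _
          fun i _ => pow_nonneg hq0.le i

lemma tendstoInMeasure_depth_div_log [IsProbabilityMeasure P] {c : ℝ}
    (hup : ∀ b > c, Tendsto
      (fun n : ℕ => P.real {ω | b * Real.log n < depth (fun i => X i ω) n}) atTop (𝓝 0))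
    (hlow : ∀ b < c, Tendsto
      (fun n : ℕ => P.real {ω | (depth (fun i => X i ω) n : ℝ) ≤ b * Real.log n}) atTop (𝓝 0)) :
    TendstoInMeasure P (fun (n : ℕ) ω => (depth (fun i => X i ω) n : ℝ) / Real.log n) atTop
      fun _ => c := by
  rw [tendstoInMeasure_iff_measureReal_dist]
  intro ε hε
  have h := (hup (c + ε / 2) (by linarith)).add (hlow (c - ε / 2) (by linarith))
  rw [add_zero] at h
  refine tendsto_of_tendsto_of_tendsto_of_le_of_le' tendsto_const_nhds h
    (Eventually.of_forall fun _ => measureReal_nonneg) ?_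
  filter_upwards [tendsto_log_natCast_atTop.eventually_gt_atTop 0] with n hn
  refine le_trans (measureReal_mono fun ω hω => ?_) (measureReal_union_le _ _)
  have hω' : ε ≤ |(depth (fun i => X i ω) n : ℝ) / Real.log n - c| := hω
  rcases le_abs.1 hω' with h | h
  · left
    show (c + ε / 2) * Real.log n < depth (fun i => X i ω) n
    rw [← lt_div_iff₀ hn]
    linarith
  · right
    show (depth (fun i => X i ω) n : ℝ) ≤ (c - ε / 2) * Real.log n
    rw [← div_le_iff₀ hn]
    linarith

/-- Convergence in probability of `D n / log n` implies convergence of the expectations. -/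
lemma tendsto_integral_depth_div_log [IsProbabilityMeasure P] (hX : IsAttachmentSequence P ν X)
    {c : ℝ} (hc : 0 ≤ c)
    (h : TendstoInMeasure P (fun (n : ℕ) ω => (depth (fun i => X i ω) n : ℝ) / Real.log n) atTop
      fun _ => c) :
    Tendsto (fun n : ℕ => (∫ ω, (depth (fun i => X i ω) n : ℝ) ∂P) / Real.log n) atTop
      (𝓝 c) := by
  obtain ⟨A, C, hA, hC⟩ := exists_integral_depth_excess_le hX
  rw [tendstoInMeasure_iff_measureReal_dist] at h
  refine Metric.tendsto_nhds.2 fun ε hε => ?_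
  have h1 := (h (ε / 2) (half_pos hε)).const_mul (A + c)
  have h2 : Tendsto (fun n : ℕ => C / Real.log n) atTop (𝓝 0) :=
    tendsto_log_natCast_atTop.const_div_atTop C
  have h3 := (h1.add h2).eventually_lt_const
    (show (A + c) * 0 + 0 < ε / 2 by simpa using half_pos hε)
  filter_upwards [h3, tendsto_log_natCast_atTop.eventually_gt_atTop 0, eventually_ne_atTop 0]
    with n hn hlog hn0
  set D : Ω → ℝ := fun ω => (depth (fun i => X i ω) n : ℝ) with hD
  set E : Set Ω := {ω | ε / 2 ≤ dist (D ω / Real.log n) c} with hE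
  have hDi : Integrable D P := integrable_depth hX n
  have hDm : Measurable D := measurable_from_nat.comp (measurable_depth hX n)
  have hEm : MeasurableSet E :=
    measurableSet_le measurable_const ((hDm.div_const _).dist measurable_const)
  have hEi : Integrable (E.indicator (1 : Ω → ℝ)) P := (integrable_const 1).indicator hEm
  have hexi : Integrable (fun ω => max (D ω - A * Real.log n) 0) P :=
    (hDi.sub (integrable_const _)).pos_part
  have hsi : Integrable (fun ω => ε / 2 + (A + c) * E.indicator (1 : Ω → ℝ) ω) P :=
    (integrable_const _).add (hEi.const_mul _)
  -- Off `E` the deviation is below `ε / 2`; on `E` it is at most `A + c` plus the scaled excess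
  -- over `A log n`. This takes the place of uniform integrability.
  have hpt : ∀ ω, |D ω / Real.log n - c| ≤ ε / 2 + (A + c) * E.indicator (1 : Ω → ℝ) ω +
      max (D ω - A * Real.log n) 0 / Real.log n := by
    intro ω
    have hx0 : 0 ≤ D ω / Real.log n := div_nonneg (Nat.cast_nonneg _) hlog.le
    have hm : D ω / Real.log n - A ≤ max (D ω - A * Real.log n) 0 / Real.log n := by
      rw [le_div_iff₀ hlog, sub_mul, div_mul_cancel₀ _ hlog.ne']
      exact le_max_left _ _
    have hm0 : 0 ≤ max (D ω - A * Real.log n) 0 / Real.log n :=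
      div_nonneg (le_max_right _ _) hlog.le
    by_cases hω : ω ∈ E
    · rw [Set.indicator_of_mem hω, Pi.one_apply]
      rw [abs_le]
      constructor <;> linarith
    · rw [Set.indicator_of_notMem hω]
      have : |D ω / Real.log n - c| < ε / 2 := not_le.1 hω
      linarith
  have hint : (∫ ω, D ω ∂P) / Real.log n - c = ∫ ω, (D ω / Real.log n - c) ∂P := by
    rw [integral_sub (hDi.div_const _) (integrable_const c), integral_div]
    simp
  have hE0 : E = {ω | ε / 2 ≤ dist ((depth (fun i => X i ω) n : ℝ) / Real.log n) c} := rfl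
  rw [Real.dist_eq, hint]
  calc |∫ ω, (D ω / Real.log n - c) ∂P| ≤ ∫ ω, |D ω / Real.log n - c| ∂P :=
        abs_integral_le_integral_abs
    _ ≤ ∫ ω, (ε / 2 + (A + c) * E.indicator (1 : Ω → ℝ) ω +
          max (D ω - A * Real.log n) 0 / Real.log n) ∂P :=
        integral_mono ((hDi.div_const _).sub (integrable_const c)).abs
          (hsi.add (hexi.div_const _)) hpt
    _ = ε / 2 + (A + c) * P.real E +
          (∫ ω, max (D ω - A * Real.log n) 0 ∂P) / Real.log n := by
        rw [integral_add hsi (hexi.div_const _),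
          integral_add (integrable_const _) (hEi.const_mul _), integral_const_mul,
          integral_indicator_one hEm, integral_div (Real.log n)]
        simp
    _ ≤ ε / 2 + (A + c) * P.real E + C / Real.log n := by
        gcongr
        exact hC n hn0
    _ < ε := by
        rw [hE0]
        linarith

end Convergence

/-! ### Distribution functions and convergence in law. -/

section WeakConvergence

/-- The jump of the distribution function at `x` is the mass of `{x}`. -/
lemma continuous_cdf (μ : Measure ℝ) [IsProbabilityMeasure μ] (h : ∀ x, μ {x} = 0) :
    Continuous (cdf μ) := by
  refine continuous_iff_continuousAt.2 fun x => ?_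
  rw [(monotone_cdf μ).continuousAt_iff_leftLim_eq_rightLim, StieltjesFunction.rightLim_eq]
  have h1 := StieltjesFunction.measure_singleton (cdf μ) x
  rw [measure_cdf, h x, eq_comm, ENNReal.ofReal_eq_zero] at h1
  exact le_antisymm ((monotone_cdf μ).leftLim_le le_rfl) (by linarith)

/-- Pointwise convergence of distribution functions implies weak convergence. -/
lemma tendsto_probabilityMeasure_of_tendsto_Iic {ρ : ℕ → ProbabilityMeasure ℝ}
    {μ : ProbabilityMeasure ℝ} (h : ∀ s, Tendsto (fun n => (ρ n : Measure ℝ).real (Set.Iic s)) atTop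
      (𝓝 ((μ : Measure ℝ).real (Set.Iic s)))) : Tendsto ρ atTop (𝓝 μ) := by
  refine (isPiSystem_Ioc (id : ℝ → ℝ) id).tendsto_probabilityMeasure_of_tendsto_of_mem ?_ ?_ ?_
  · rintro s ⟨a, b, _, rfl⟩
    exact measurableSet_Ioc
  · intro u hu x hx
    obtain ⟨a, b, hab, hsub⟩ := mem_nhds_iff_exists_Ioo_subset.1 (hu.mem_nhds hx)
    obtain ⟨c, hc1, hc2⟩ := exists_between hab.2
    exact ⟨Set.Ioc a c, ⟨a, c, hab.1.trans hc1, rfl⟩, Ioc_mem_nhds hab.1 hc1,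
      fun y hy => hsub ⟨hy.1, hy.2.trans_lt hc2⟩⟩
  · rintro s ⟨a, b, hab, rfl⟩
    have hab' : a ≤ b := le_of_lt hab
    have key : ∀ ρ : ProbabilityMeasure ℝ, (ρ : Measure ℝ).real (Set.Ioc a b) =
        (ρ : Measure ℝ).real (Set.Iic b) - (ρ : Measure ℝ).real (Set.Iic a) := by
      intro ρ
      have : Set.Ioc a b = Set.Iic b \ Set.Iic a := by
        ext x
        simp [and_comm]
      rw [this, measureReal_sdiff (Set.Iic_subset_Iic.2 hab') measurableSet_Iic]
    rw [← NNReal.tendsto_coe]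
    have h1 := (h b).sub (h a)
    simp only [← key] at h1
    exact h1

variable {Ω : Type*} [MeasurableSpace Ω] {P : Measure Ω} [IsProbabilityMeasure P]

lemma tendstoInDistribution_of_tendsto_cdf {μ : Measure ℝ} [IsProbabilityMeasure μ]
    {Z : ℕ → Ω → ℝ} (hZ : ∀ n, Measurable (Z n))
    (h : ∀ s, Tendsto (fun n => P.real {ω | Z n ω ≤ s}) atTop (𝓝 (cdf μ s))) :
    TendstoInDistribution Z atTop (id : ℝ → ℝ) (fun _ => P) μ where
  forall_aemeasurable n := (hZ n).aemeasurable
  aemeasurable_limit := aemeasurable_id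
  tendsto := by
    refine tendsto_probabilityMeasure_of_tendsto_Iic fun s => ?_
    have hmap : ∀ n, (P.map (Z n)).real (Set.Iic s) = P.real {ω | Z n ω ≤ s} := fun n =>
      map_measureReal_apply (hZ n) measurableSet_Iic
    have hid : (μ.map id).real (Set.Iic s) = cdf μ s := by rw [Measure.map_id, cdf_eq_real]
    have h1 := h s
    simp only [← hmap, ← hid] at h1
    exact h1

lemma tendsto_measureReal_Iic_of_tendsto {ρ : ℕ → ProbabilityMeasure ℝ}
    {μ : ProbabilityMeasure ℝ} (h : Tendsto ρ atTop (𝓝 μ)) {s : ℝ} (hs : (μ : Measure ℝ) {s} = 0) :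
    Tendsto (fun n => (ρ n : Measure ℝ).real (Set.Iic s)) atTop
      (𝓝 ((μ : Measure ℝ).real (Set.Iic s))) :=
  (ENNReal.tendsto_toReal (measure_ne_top _ _)).comp
    (ProbabilityMeasure.tendsto_measure_of_null_frontier_of_tendsto' h (E := Set.Iic s)
      (by simpa using hs))

lemma tendsto_cdf_of_tendstoInDistribution {μ : Measure ℝ} [IsProbabilityMeasure μ]
    {Z : ℕ → Ω → ℝ} (hZ : ∀ n, Measurable (Z n))
    (h : TendstoInDistribution Z atTop (id : ℝ → ℝ) (fun _ => P) μ) {s : ℝ} (hs : μ {s} = 0) :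
    Tendsto (fun n => P.real {ω | Z n ω ≤ s}) atTop (𝓝 (cdf μ s)) := by
  have hs' : (μ.map id) {s} = 0 := by rwa [Measure.map_id]
  have h1 := tendsto_measureReal_Iic_of_tendsto h.tendsto hs'
  have hmap : ∀ n, (P.map (Z n)).real (Set.Iic s) = P.real {ω | Z n ω ≤ s} := fun n =>
    map_measureReal_apply (hZ n) measurableSet_Iic
  have hid : (μ.map id).real (Set.Iic s) = cdf μ s := by rw [Measure.map_id, cdf_eq_real]
  simp only [← hmap, ← hid]
  exact h1

/-- The shifts by `δ` absorb perturbations of the threshold, the added `δ` the probability of a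
large rounding error. -/
lemma tendsto_of_cdf_sandwich {F : ℕ → ℝ → ℝ} {Φ : ℝ → ℝ} (hΦ : Continuous Φ)
    (hF : ∀ s, Tendsto (fun n => F n s) atTop (𝓝 (Φ s))) {u : ℕ → ℝ} {s : ℝ}
    (h1 : ∀ δ > 0, ∀ᶠ n in atTop, F n (s - δ) ≤ u n)
    (h2 : ∀ δ > 0, ∀ᶠ n in atTop, u n ≤ F n (s + δ) + δ) :
    Tendsto u atTop (𝓝 (Φ s)) := by
  have hlow : Tendsto (fun δ => Φ (s - δ)) (𝓝[>] 0) (𝓝 (Φ s)) := by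
    have : Continuous fun δ => Φ (s - δ) := by fun_prop
    simpa using (this.tendsto 0).mono_left nhdsWithin_le_nhds
  have hup : Tendsto (fun δ => Φ (s + δ) + δ) (𝓝[>] 0) (𝓝 (Φ s)) := by
    have : Continuous fun δ => Φ (s + δ) + δ := by fun_prop
    simpa using (this.tendsto 0).mono_left nhdsWithin_le_nhds
  refine tendsto_order.2 ⟨fun a ha => ?_, fun a ha => ?_⟩
  · obtain ⟨δ, hδ, hδ0⟩ := ((hlow.eventually_const_lt ha).and self_mem_nhdsWithin).exists
    filter_upwards [h1 δ hδ0, (hF (s - δ)).eventually_const_lt hδ] with n h3 h4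
    exact h4.trans_le h3
  · obtain ⟨δ, hδ, hδ0⟩ := ((hup.eventually_lt_const ha).and self_mem_nhdsWithin).exists
    filter_upwards [h2 δ hδ0, ((hF (s + δ)).add_const δ).eventually_lt_const hδ] with n h3 h4
    exact h3.trans_lt h4

end WeakConvergence

/-! ### Asymptotics of `⌊y ^ 2 + c * y⌋`, used with `y = √(log n / m)`. -/

section FloorAsymptotics

variable (c : ℝ)

lemma tendsto_floor_sq_add_sub_div :
    Tendsto (fun y : ℝ => ((⌊y ^ 2 + c * y⌋₊ : ℝ) - y ^ 2) / y) atTop (𝓝 c) := by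
  have h0 : Tendsto (fun y : ℝ => c - y⁻¹) atTop (𝓝 c) := by
    simpa using (tendsto_const_nhds (x := c)).sub (tendsto_inv_atTop_zero (𝕜 := ℝ))
  refine tendsto_of_tendsto_of_tendsto_of_le_of_le' h0 tendsto_const_nhds ?_ ?_
  · filter_upwards [eventually_gt_atTop 0] with y hy
    rw [le_div_iff₀ hy, sub_mul, inv_mul_cancel₀ hy.ne']
    linarith [Nat.lt_floor_add_one (y ^ 2 + c * y)]
  · filter_upwards [eventually_gt_atTop 0, eventually_ge_atTop (-c)] with y hy hyc
    rw [div_le_iff₀ hy]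
    have : 0 ≤ y ^ 2 + c * y := by nlinarith
    linarith [Nat.floor_le this]

lemma tendsto_sqrt_floor_sq_add_div :
    Tendsto (fun y : ℝ => √(⌊y ^ 2 + c * y⌋₊ : ℝ) / y) atTop (𝓝 1) := by
  have h1 : Tendsto (fun y : ℝ => ((⌊y ^ 2 + c * y⌋₊ : ℝ) - y ^ 2) / y * y⁻¹ + 1) atTop
      (𝓝 (c * 0 + 1)) :=
    ((tendsto_floor_sq_add_sub_div c).mul tendsto_inv_atTop_zero).add_const 1
  have h2 := h1.sqrt
  rw [mul_zero, zero_add, Real.sqrt_one] at h2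
  refine h2.congr' ?_
  filter_upwards [eventually_gt_atTop 0] with y hy
  have : ((⌊y ^ 2 + c * y⌋₊ : ℝ) - y ^ 2) / y * y⁻¹ + 1 = (⌊y ^ 2 + c * y⌋₊ : ℝ) / y ^ 2 := by
    field_simp
    ring
  rw [this, Real.sqrt_div (Nat.cast_nonneg _), Real.sqrt_sq hy.le]

lemma tendsto_sqrt_floor_sq_add :
    Tendsto (fun y : ℝ => √(⌊y ^ 2 + c * y⌋₊ : ℝ)) atTop atTop := by
  refine ((tendsto_sqrt_floor_sq_add_div c).pos_mul_atTop one_pos tendsto_id).congr' ?_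
  filter_upwards [eventually_gt_atTop 0] with y hy
  exact div_mul_cancel₀ _ hy.ne'

lemma tendsto_floor_sq_add : Tendsto (fun y : ℝ => ⌊y ^ 2 + c * y⌋₊) atTop atTop := by
  refine tendsto_nat_floor_atTop.comp ?_
  have h : Tendsto (fun y : ℝ => y * (y + c)) atTop atTop :=
    tendsto_id.atTop_mul_atTop₀ (tendsto_atTop_add_const_right _ c tendsto_id)
  exact h.congr fun y => by ring

lemma tendsto_floor_sq_add_sub_div_sqrt :
    Tendsto (fun y : ℝ => ((⌊y ^ 2 + c * y⌋₊ : ℝ) - y ^ 2) / √(⌊y ^ 2 + c * y⌋₊ : ℝ))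
      atTop (𝓝 c) := by
  have h := (tendsto_floor_sq_add_sub_div c).div (tendsto_sqrt_floor_sq_add_div c) one_ne_zero
  rw [div_one] at h
  refine h.congr' ?_
  filter_upwards [eventually_gt_atTop 0] with y hy
  simp only [Pi.div_apply]
  rw [div_div_div_cancel_right₀ hy.ne']

end FloorAsymptotics

/-! ### Integrability of `log X` and its truncations. -/

section LogMean

variable {Ω : Type*} [MeasurableSpace Ω] {P : Measure Ω} {ν : Measure ℝ} {X : ℕ → Ω → ℝ}

lemma measurable_negLog : Measurable negLog :=
  Measurable.ite (measurableSet_singleton 0) measurable_const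
    (ENNReal.measurable_ofReal.comp Real.measurable_log.neg)

lemma ae_ne_zero_of_logMean_lt_top (h : logMean ν < ∞) : ∀ᵐ x ∂ν, x ≠ 0 := by
  filter_upwards [ae_lt_top measurable_negLog h.ne] with x hx hx0
  simp [negLog, hx0] at hx

lemma logMean_eq_lintegral (h : logMean ν < ∞) :
    logMean ν = ∫⁻ x, ENNReal.ofReal (-Real.log x) ∂ν := by
  refine lintegral_congr_ae ?_
  filter_upwards [ae_ne_zero_of_logMean_lt_top h] with x hx
  simp [negLog, hx]

lemma neg_log_nonneg {x : ℝ} (hx : x ∈ Set.Ico (0 : ℝ) 1) : 0 ≤ -Real.log x :=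
  neg_nonneg.2 (Real.log_nonpos hx.1 hx.2.le)

lemma integrable_log (hX : IsAttachmentSequence P ν X) (h : logMean ν < ∞) :
    Integrable Real.log ν := by
  rw [← integrable_neg_iff]
  refine ⟨Real.measurable_log.neg.aestronglyMeasurable, ?_⟩
  rw [hasFiniteIntegral_iff_ofReal]
  · simpa [logMean_eq_lintegral h] using h
  · filter_upwards [hX.ae_mem_Ico] with x hx using neg_log_nonneg hx

lemma integral_log (hX : IsAttachmentSequence P ν X) (h : logMean ν < ∞) :
    ∫ x, Real.log x ∂ν = -(logMean ν).toReal := by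
  have : ∫ x, -Real.log x ∂ν = (logMean ν).toReal := by
    rw [integral_eq_lintegral_of_nonneg_ae, logMean_eq_lintegral h]
    · filter_upwards [hX.ae_mem_Ico] with x hx using neg_log_nonneg hx
    · exact Real.measurable_log.neg.aestronglyMeasurable
  rw [← this, integral_neg, neg_neg]

lemma toReal_logMean_pos [IsProbabilityMeasure P] (hX : IsAttachmentSequence P ν X)
    (h : logMean ν < ∞) : 0 < (logMean ν).toReal := by
  have := hX.isProbabilityMeasure
  refine ENNReal.toReal_pos (fun h0 => ?_) h.ne
  rw [logMean, lintegral_eq_zero_iff measurable_negLog] at h0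
  have : ∀ᵐ x ∂ν, False := by
    filter_upwards [h0, hX.ae_mem_Ico, ae_ne_zero_of_logMean_lt_top h] with x h1 h2 h3
    have h4 := Real.log_neg (lt_of_le_of_ne h2.1 h3.symm) h2.2
    simp only [negLog, h3, if_false, Pi.zero_apply, ENNReal.ofReal_eq_zero] at h1
    linarith
  simpa using this.exists

lemma integrable_log_max [IsProbabilityMeasure P] (hX : IsAttachmentSequence P ν X) {δ : ℝ}
    (hδ : 0 < δ) (hδ1 : δ < 1) : Integrable (fun x => Real.log (max x δ)) ν := by
  have := hX.isProbabilityMeasure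
  refine Integrable.of_mem_Icc (Real.log δ) 0
    (Real.measurable_log.comp (measurable_id.max measurable_const)).aemeasurable ?_
  filter_upwards [hX.ae_mem_Ico] with x hx
  exact ⟨Real.log_le_log hδ (le_max_right _ _),
    Real.log_nonpos (hδ.le.trans (le_max_right _ _)) (max_le hx.2.le hδ1.le)⟩

/-- If `E[-log X] = ∞`, then the truncations of `log X` have arbitrarily negative mean. -/
lemma exists_integral_log_max_lt [IsProbabilityMeasure P] (hX : IsAttachmentSequence P ν X)
    (h : logMean ν = ∞) (M : ℝ) :
    ∃ δ : ℝ, 0 < δ ∧ δ < 1 ∧ ∫ x, Real.log (max x δ) ∂ν < -M := by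
  have hδ : ∀ k : ℕ, (0 : ℝ) < 1 / ((k : ℝ) + 2) ∧ 1 / ((k : ℝ) + 2) < 1 := fun k => by
    have : (0 : ℝ) ≤ k := Nat.cast_nonneg k
    refine ⟨by positivity, ?_⟩
    rw [div_lt_one (by positivity)]
    linarith
  have hlim : Tendsto (fun k : ℕ => 1 / ((k : ℝ) + 2)) atTop (𝓝[>] 0) := by
    refine tendsto_nhdsWithin_iff.2 ⟨?_, Eventually.of_forall fun k => (hδ k).1⟩
    exact (tendsto_atTop_add_const_right _ 2 tendsto_natCast_atTop_atTop).const_div_atTop 1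
  -- Monotone convergence: the truncated values of `-log x` increase to `negLog x`, including to `∞`
  -- at `x = 0`.
  have hmono := lintegral_tendsto_of_tendsto_of_monotone (μ := ν)
    (f := fun (k : ℕ) x => ENNReal.ofReal (-Real.log (max x (1 / ((k : ℝ) + 2))))) (F := negLog)
    (fun k => (ENNReal.measurable_ofReal.comp (Real.measurable_log.comp
      (measurable_id.max measurable_const)).neg).aemeasurable)
    (Eventually.of_forall fun x k l hkl => by
      refine ENNReal.ofReal_le_ofReal (neg_le_neg (Real.log_le_log
        ((hδ l).1.trans_le (le_max_right _ _)) (max_le_max le_rfl ?_)))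
      have : (k : ℝ) ≤ l := by exact_mod_cast hkl
      have : (0 : ℝ) ≤ k := Nat.cast_nonneg k
      gcongr)
    (by
      filter_upwards [hX.ae_mem_Ico] with x hx
      rcases hx.1.eq_or_lt with rfl | hx0
      · simp only [negLog, if_true]
        refine ENNReal.tendsto_ofReal_atTop.comp (tendsto_neg_atBot_atTop.comp ?_)
        refine (Real.tendsto_log_nhdsGT_zero.comp hlim).congr fun k => ?_
        rw [Function.comp_apply, max_eq_right (hδ k).1.le]
      · simp only [negLog, hx0.ne', if_false]
        refine tendsto_const_nhds.congr' ?_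
        filter_upwards [(tendsto_nhdsWithin_iff.1 hlim).1.eventually_le_const hx0] with k hk
        rw [max_eq_left hk])
  have htop : ∫⁻ x, negLog x ∂ν = ∞ := h
  rw [htop] at hmono
  obtain ⟨k, hk⟩ := (hmono.eventually_const_lt (ENNReal.ofReal_lt_top (r := M))).exists
  refine ⟨_, (hδ k).1, (hδ k).2, ?_⟩
  have hnn : 0 ≤ᵐ[ν] fun x => -Real.log (max x (1 / ((k : ℝ) + 2))) := by
    filter_upwards [hX.ae_mem_Ico] with x hx
    exact neg_nonneg.2 (Real.log_nonpos ((hδ k).1.le.trans (le_max_right _ _))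
      (max_le hx.2.le (hδ k).2.le))
  have hint : Integrable (fun x => -Real.log (max x (1 / ((k : ℝ) + 2)))) ν :=
    (integrable_log_max hX (hδ k).1 (hδ k).2).neg
  rw [← ofReal_integral_eq_lintegral_ofReal hint hnn] at hk
  have := (ENNReal.ofReal_lt_ofReal_iff'.1 hk).1
  rw [integral_neg] at this
  linarith

end LogMean

/-! ### The central limit theorem for the depth. -/

section Normal

variable {Ω : Type*} [MeasurableSpace Ω] {P : Measure Ω} {ν : Measure ℝ} {X : ℕ → Ω → ℝ}

/-- The central limit theorem for `log X`, in terms of distribution functions. -/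
lemma tendsto_measureReal_sum_log_le [IsProbabilityMeasure P] (hX : IsAttachmentSequence P ν X)
    {m σ : ℝ} (hσ : 0 < σ) (hi : Integrable Real.log ν) (hm : ∫ x, Real.log x ∂ν = -m)
    (hv : ∫ x, (Real.log x + m) ^ 2 ∂ν = σ ^ 2) (s : ℝ) :
    Tendsto (fun j : ℕ => P.real
      {ω | ∑ i ∈ Finset.range j, Real.log (X i ω) ≤ σ * √j * s - m * j}) atTop
      (𝓝 (cdf (gaussianReal 0 1) s)) := by
  have := hX.isProbabilityMeasure
  set g : ℝ → ℝ := fun x => (Real.log x + m) / σ with hg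
  have hgm : Measurable g := (Real.measurable_log.add_const m).div_const σ
  have h0 : ∫ ω, g (X 0 ω) ∂P = 0 := by
    rw [hX.integral_comp hgm, hg, integral_div, integral_add hi (integrable_const m), hm]
    simp
  have h1 : ∫ ω, g (X 0 ω) ^ 2 ∂P = 1 := by
    rw [hX.integral_comp (g := fun x => g x ^ 2) (hgm.pow_const 2)]
    simp only [hg, div_pow]
    rw [integral_div, hv, div_self (by positivity)]
  have hclt := tendstoInDistribution_inv_sqrt_mul_sum (P := P) (X := fun i ω => g (X i ω))
    (P' := gaussianReal 0 1) (Y := (id : ℝ → ℝ)) ⟨aemeasurable_id, Measure.map_id⟩ h0 h1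
    (hX.indep.comp (fun _ => g) fun _ => hgm) (hX.identDistrib hgm)
  have hat : (gaussianReal 0 1) {s} = 0 := by
    have := nullSingletonClass_gaussianReal (μ := 0) (v := 1) one_ne_zero
    exact measure_singleton s
  have h2 := tendsto_cdf_of_tendstoInDistribution (fun j => (Finset.measurable_fun_sum
    (Finset.range j) fun i _ => hgm.comp (hX.measurable i)).const_mul ((√(j : ℝ))⁻¹)) hclt hat
  refine h2.congr' ?_
  filter_upwards [eventually_gt_atTop 0] with j hj
  have hj' : 0 < √(j : ℝ) := Real.sqrt_pos.2 (by exact_mod_cast hj)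
  congr 1
  ext ω
  have h3 : ∑ i ∈ Finset.range j, g (X i ω) =
      (∑ i ∈ Finset.range j, Real.log (X i ω) + m * j) / σ := by
    simp only [hg]
    rw [← Finset.sum_div, Finset.sum_add_distrib]
    simp [mul_comm]
  show (√(j : ℝ))⁻¹ * ∑ i ∈ Finset.range j, g (X i ω) ≤ s ↔
    ∑ i ∈ Finset.range j, Real.log (X i ω) ≤ σ * √j * s - m * j
  rw [h3, inv_mul_le_iff₀ hj', div_le_iff₀ hσ, ← le_sub_iff_add_le]
  ring_nf

lemma tendsto_measureReal_depth_le_normal [IsProbabilityMeasure P]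
    (hX : IsAttachmentSequence P ν X) {m σ : ℝ} (hm0 : 0 < m) (hσ : 0 < σ)
    (h0 : ∀ᵐ x ∂ν, x ≠ 0) (hi : Integrable Real.log ν) (hm : ∫ x, Real.log x ∂ν = -m)
    (hv : ∫ x, (Real.log x + m) ^ 2 ∂ν = σ ^ 2) (s : ℝ) :
    Tendsto (fun n : ℕ => P.real {ω | ((depth (fun i => X i ω) n : ℝ) - Real.log n / m) /
      (σ * √(Real.log n / m ^ 3)) ≤ s}) atTop (𝓝 (cdf (gaussianReal 0 1) s)) := by
  -- As `log n / m = y ^ 2` and `σ √(log n / m ^ 3) = σ * y / m`, the event in question is `D n ≤ y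
  -- ^ 2 + c * y`.
  set c : ℝ := s * σ / m with hc
  set y : ℕ → ℝ := fun n => √(Real.log n / m) with hy
  have hyt : Tendsto y atTop atTop := by
    exact Real.tendsto_sqrt_atTop.comp (tendsto_log_natCast_atTop.atTop_div_const hm0)
  set j : ℕ → ℕ := fun n => ⌊y n ^ 2 + c * y n⌋₊ with hj
  have hjt : Tendsto j atTop atTop := (tendsto_floor_sq_add c).comp hyt
  have hsq : Tendsto (fun n => √(j n : ℝ)) atTop atTop := (tendsto_sqrt_floor_sq_add c).comp hyt
  have hr : Tendsto (fun n => ((j n : ℝ) - y n ^ 2) / √(j n : ℝ)) atTop (𝓝 c) :=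
    (tendsto_floor_sq_add_sub_div_sqrt c).comp hyt
  -- This sequence `s_n` solves `σ √j * s_n - m * j = -log n`: it is the threshold `-log n` in the
  -- normalisation of the central limit theorem.
  have hr' : Tendsto (fun n => m / σ * (((j n : ℝ) - y n ^ 2) / √(j n : ℝ))) atTop (𝓝 s) := by
    have := hr.const_mul (m / σ)
    have hcs : m / σ * c = s := by
      rw [hc]
      field_simp
    rwa [hcs] at this
  have hy2 : ∀ n, m * y n ^ 2 = Real.log n := fun n => by
    rw [hy, Real.sq_sqrt (div_nonneg (Real.log_natCast_nonneg n) hm0.le)]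
    field_simp
  have hset : ∀ᶠ n : ℕ in atTop, P.real {ω | ((depth (fun i => X i ω) n : ℝ) - Real.log n / m) /
      (σ * √(Real.log n / m ^ 3)) ≤ s} = P.real {ω | depth (fun i => X i ω) n ≤ j n} := by
    -- The condition `y ≥ -c` makes `y ^ 2 + c * y` nonnegative, so that the natural floor does not
    -- truncate at zero.
    filter_upwards [hyt.eventually_gt_atTop 0, hyt.eventually_ge_atTop (-c)] with n hn hnc
    have h1 : √(Real.log n / m ^ 3) = y n / m := by
      rw [show Real.log n / m ^ 3 = (Real.log n / m) / m ^ 2 by field_simp,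
        Real.sqrt_div (div_nonneg (Real.log_natCast_nonneg n) hm0.le), Real.sqrt_sq hm0.le]
    have h2 : Real.log n / m = y n ^ 2 := by
      rw [← hy2 n]
      field_simp
    congr 1
    ext ω
    show ((depth (fun i => X i ω) n : ℝ) - Real.log n / m) /
      (σ * √(Real.log n / m ^ 3)) ≤ s ↔ depth (fun i => X i ω) n ≤ j n
    rw [h1, h2, div_le_iff₀ (by positivity), hj, Nat.le_floor_iff (by nlinarith),
      sub_le_iff_le_add', hc]
    ring_nf
  refine Tendsto.congr' (hset.mono fun n h => h.symm) ?_
  have hcont : Continuous (cdf (gaussianReal 0 1)) := continuous_cdf _ fun x => by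
    have := nullSingletonClass_gaussianReal (μ := 0) (v := 1) one_ne_zero
    exact measure_singleton x
  have hms : ∀ k : ℕ, ∀ a : ℝ,
      MeasurableSet {ω | a ≤ ∑ i ∈ Finset.range k, Real.log (X i ω)} := fun k a =>
    measurableSet_le measurable_const (Finset.measurable_fun_sum _ fun i _ =>
      Real.measurable_log.comp (hX.measurable i))
  refine tendsto_of_cdf_sandwich
    (F := fun n s => P.real {ω | ∑ i ∈ Finset.range (j n), Real.log (X i ω) ≤
      σ * √(j n) * s - m * (j n)}) hcont
    (fun s => (tendsto_measureReal_sum_log_le hX hσ hi hm hv s).comp hjt) ?_ ?_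
  · intro δ hδ
    filter_upwards [hr'.eventually_const_lt (sub_lt_self s hδ), hsq.eventually_gt_atTop 0]
      with n h1 h2
    have h3 : σ * √(j n : ℝ) * (s - δ) - m * (j n) < -Real.log n := by
      have h4 := mul_lt_mul_of_pos_left h1 (mul_pos hσ h2)
      have h5 : σ * √(j n : ℝ) * (m / σ * (((j n : ℝ) - y n ^ 2) / √(j n : ℝ))) =
          m * (j n) - Real.log n := by
        rw [← hy2 n]
        field_simp
      linarith
    have h6 := measureReal_lt_depth_le_sum hX (g := Real.log) (fun x _ => Real.le_exp_log x)
      n (j n)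
    have h7 : {ω | j n < depth (fun i => X i ω) n} = {ω | depth (fun i => X i ω) n ≤ j n}ᶜ := by
      ext ω
      simp
    have hmd : MeasurableSet {ω | depth (fun i => X i ω) n ≤ j n} :=
      measurable_depth hX n measurableSet_Iic
    rw [h7, probReal_compl_eq_one_sub hmd] at h6
    have h8 : P.real {ω | -Real.log n ≤ ∑ i ∈ Finset.range (j n), Real.log (X i ω)}ᶜ =
        1 - P.real {ω | -Real.log n ≤ ∑ i ∈ Finset.range (j n), Real.log (X i ω)} :=
      probReal_compl_eq_one_sub (hms _ _)
    have h9 : P.real {ω | ∑ i ∈ Finset.range (j n), Real.log (X i ω) ≤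
        σ * √(j n) * (s - δ) - m * (j n)} ≤
        P.real {ω | -Real.log n ≤ ∑ i ∈ Finset.range (j n), Real.log (X i ω)}ᶜ :=
      measureReal_mono fun ω hω => not_le.2 (lt_of_le_of_lt hω h3)
    linarith
  · intro δ hδ
    set C : ℝ := (1 - ∫ x, x ∂ν)⁻¹ with hC
    have hC0 : 0 < C := inv_pos.2 (sub_pos.2 hX.integral_id_lt_one)
    -- The choice `K = C / δ` makes the rounding probability exactly `δ`, while `log K` is
    -- negligible against `√j`.
    have hK : Tendsto (fun n => m / σ * (((j n : ℝ) - y n ^ 2) / √(j n : ℝ)) +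
        Real.log (C / δ) / σ / √(j n : ℝ)) atTop (𝓝 (s + 0)) :=
      hr'.add (hsq.const_div_atTop _)
    rw [add_zero] at hK
    filter_upwards [hK.eventually_lt_const (lt_add_of_pos_right s hδ),
      hsq.eventually_gt_atTop 0, eventually_ne_atTop 0] with n h1 h2 hn0
    have h3 : Real.log (C / δ) - Real.log n ≤ σ * √(j n : ℝ) * (s + δ) - m * (j n) := by
      have h4 := mul_lt_mul_of_pos_left h1 (mul_pos hσ h2)
      have h5 : σ * √(j n : ℝ) * (m / σ * (((j n : ℝ) - y n ^ 2) / √(j n : ℝ)) +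
          Real.log (C / δ) / σ / √(j n : ℝ)) =
          m * (j n) - Real.log n + Real.log (C / δ) := by
        rw [← hy2 n]
        field_simp
      linarith
    have h6 := measureReal_depth_le_sum hX h0 hn0 (div_pos hC0 hδ) (j n)
    rw [← hC, div_div_cancel₀ hC0.ne'] at h6
    refine h6.trans (add_le_add_left (measureReal_mono fun ω hω => ?_) _)
    exact le_trans (show ∑ i ∈ Finset.range (j n), Real.log (X i ω) ≤ _ from hω) h3

end Normal

/-! ### Constant attachment. -/

section Constant

/-- For a constant attachment value, the depth is within a bounded distance of its asymptotics. -/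
lemma exists_abs_depth_const_sub_le {r : ℝ} (hr0 : 0 < r) (hr1 : r < 1) :
    ∃ C : ℝ, ∀ n ≠ 0, |(depth (fun _ => r) n : ℝ) - Real.log n / (-Real.log r)| ≤ C := by
  have hx : ∀ i : ℕ, (fun _ : ℕ => r) i ∈ Set.Ico (0 : ℝ) 1 := fun _ => ⟨hr0.le, hr1⟩
  have hm : 0 < -Real.log r := neg_pos.2 (Real.log_neg hr0 hr1)
  -- The `1` bounds the error above, since the label is nonzero one step before the depth; the other
  -- term comes from the geometric series bounding the rounding error.
  refine ⟨max 1 (Real.log (1 - r)⁻¹ / (-Real.log r)), fun n hn => ?_⟩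
  have hn' : (0 : ℝ) < n := by positivity
  set d := depth (fun _ => r) n with hd
  rw [abs_le]
  constructor
  · have h1 := le_revLabel (x := fun _ => r) (fun _ => hr0.le) n d
    rw [← label_const, (depth_le_iff hx).1 hd.le] at h1
    simp only [Finset.prod_const, Finset.card_range, Nat.cast_zero, zero_add] at h1
    have h2 : (n : ℝ) * r ^ d ≤ (1 - r)⁻¹ := by
      refine h1.trans ?_
      rw [← tsum_geometric_of_lt_one hr0.le hr1]
      exact (summable_geometric_of_lt_one hr0.le hr1).sum_le_tsum _ fun i _ => pow_nonneg hr0.le i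
    have h3 := Real.log_le_log (by positivity) h2
    rw [Real.log_mul hn'.ne' (by positivity), Real.log_pow] at h3
    have h4 : Real.log n / (-Real.log r) - d ≤ Real.log (1 - r)⁻¹ / (-Real.log r) := by
      rw [sub_le_iff_le_add, div_le_iff₀ hm, add_mul, div_mul_cancel₀ _ hm.ne']
      linarith
    linarith [le_max_right 1 (Real.log (1 - r)⁻¹ / (-Real.log r))]
  · have hlog : 0 ≤ Real.log n / (-Real.log r) := div_nonneg (Real.log_natCast_nonneg n) hm.le
    rcases Nat.eq_zero_or_pos d with h0 | h0
    · rw [h0, Nat.cast_zero]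
      linarith [le_max_left 1 (Real.log (1 - r)⁻¹ / (-Real.log r))]
    · obtain ⟨k, hk⟩ := Nat.exists_eq_succ_of_ne_zero h0.ne'
      have h1 : label (fun _ => r) n k ≠ 0 := fun h => by
        have := (depth_le_iff hx).2 h
        omega
      have h2 := revLabel_le (x := fun _ => r) (fun _ => hr0.le) n k
      rw [← label_const] at h2
      simp only [Finset.prod_const, Finset.card_range] at h2
      have h3 : (1 : ℝ) ≤ label (fun _ => r) n k := by
        exact_mod_cast Nat.one_le_iff_ne_zero.2 h1
      have h4 := Real.log_le_log one_pos (h3.trans h2)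
      rw [Real.log_one, Real.log_mul hn'.ne' (by positivity), Real.log_pow] at h4
      have h5 : (k : ℝ) ≤ Real.log n / (-Real.log r) := by
        rw [le_div_iff₀ hm]
        linarith
      have h6 : (d : ℝ) = k + 1 := by rw [hk]; push_cast; ring
      linarith [le_max_left 1 (Real.log (1 - r)⁻¹ / (-Real.log r))]

lemma isLittleO_depth_const {r : ℝ} (hr0 : 0 < r) (hr1 : r < 1) :
    (fun n : ℕ => (depth (fun _ => r) n : ℝ) - Real.log n / (-Real.log r)) =o[atTop]
      fun n : ℕ => √(Real.log n) := by
  obtain ⟨C, hC⟩ := exists_abs_depth_const_sub_le hr0 hr1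
  have h1 : (fun n : ℕ => (depth (fun _ => r) n : ℝ) - Real.log n / (-Real.log r)) =O[atTop]
      fun _ : ℕ => (1 : ℝ) := by
    refine IsBigO.of_bound C ?_
    filter_upwards [eventually_ne_atTop 0] with n hn
    simpa using hC n hn
  refine h1.trans_isLittleO ((isLittleO_const_left.2 (Or.inr ?_)))
  exact tendsto_norm_atTop_atTop.comp (Real.tendsto_sqrt_atTop.comp tendsto_log_natCast_atTop)

end Constant

end Sarrt

/-! ### Assembly of the four cases. -/

theorem theorem1 {Ω : Type*} [MeasurableSpace Ω] (P : Measure Ω) [IsProbabilityMeasure P]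
    (ν : Measure ℝ) (X : ℕ → Ω → ℝ) (hX : Sarrt.IsAttachmentSequence P ν X)
    (D : ℕ → Ω → ℝ) (hD : ∀ n ω, D n ω = (Sarrt.depth (fun i => X i ω) n : ℝ))
    (m : ℝ) (hm : m = (Sarrt.logMean ν).toReal)
    (σ : ℝ) (hσ : σ = √(Sarrt.logVar ν).toReal) :
    -- the expectations below exist
    (∀ n, Integrable (D n) P) ∧
    -- (A)
    (Sarrt.logMean ν = ∞ →
      TendstoInMeasure P (fun (n : ℕ) ω => D n ω / Real.log n) atTop (fun _ => (0 : ℝ)) ∧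
      Tendsto (fun n : ℕ => (∫ ω, D n ω ∂P) / Real.log n) atTop (𝓝 0)) ∧
    -- (B)
    (Sarrt.logMean ν < ∞ →
      TendstoInMeasure P (fun (n : ℕ) ω => D n ω / Real.log n) atTop (fun _ => 1 / m) ∧
      Tendsto (fun n : ℕ => (∫ ω, D n ω ∂P) / Real.log n) atTop (𝓝 (1 / m))) ∧
    -- (C)
    (Sarrt.logMean ν < ∞ → 0 < Sarrt.logVar ν → Sarrt.logVar ν < ∞ →
      TendstoInDistribution
        (fun (n : ℕ) ω => (D n ω - Real.log n / m) / (σ * √(Real.log n / m ^ 3)))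
        atTop (id : ℝ → ℝ) (fun _ => P) (gaussianReal 0 1)) ∧
    -- (D)
    (Sarrt.logMean ν < ∞ → Sarrt.logVar ν = 0 →
      ∀ᵐ ω ∂P, (fun n : ℕ => D n ω - Real.log n / m) =o[atTop] fun n : ℕ => √(Real.log n)) := by
  open Sarrt in
  obtain rfl : D = fun n ω => (depth (fun i => X i ω) n : ℝ) := by
    funext n ω
    exact hD n ω
  have hν := hX.isProbabilityMeasure
  refine ⟨integrable_depth hX, fun h => ?_, fun h => ?_, fun h hpos hlt => ?_, fun h hzero => ?_⟩
  · have hconv : TendstoInMeasure P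
        (fun (n : ℕ) ω => (depth (fun i => X i ω) n : ℝ) / Real.log n) atTop fun _ => (0 : ℝ) := by
      refine tendstoInMeasure_depth_div_log (fun b hb => ?_) fun b hb => ?_
      · obtain ⟨δ, hδ0, hδ1, hδ⟩ := exists_integral_log_max_lt hX h b⁻¹
        refine tendsto_measureReal_lt_depth hX
          (Real.measurable_log.comp (measurable_id.max measurable_const))
          (integrable_log_max hX hδ0 hδ1) (fun x _ => ?_) hb hδ
        exact (le_max_left x δ).trans (Real.le_exp_log _)
      · refine tendsto_const_nhds.congr' ?_
        filter_upwards [tendsto_log_natCast_atTop.eventually_gt_atTop 0] with n hn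
        have : {ω | (depth (fun i => X i ω) n : ℝ) ≤ b * Real.log n} = ∅ := by
          ext ω
          have h1 : (0 : ℝ) ≤ depth (fun i => X i ω) n := Nat.cast_nonneg _
          have h2 := mul_neg_of_neg_of_pos hb hn
          simpa using h2.trans_le h1
        simp [this]
    exact ⟨hconv, tendsto_integral_depth_div_log hX le_rfl hconv⟩
  · have hm0 : 0 < m := hm ▸ toReal_logMean_pos hX h
    have hmi : ∫ x, Real.log x ∂ν = -m := hm ▸ integral_log hX h
    have h0 := ae_ne_zero_of_logMean_lt_top h
    have hi := integrable_log hX h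
    have hconv : TendstoInMeasure P
        (fun (n : ℕ) ω => (depth (fun i => X i ω) n : ℝ) / Real.log n) atTop fun _ => 1 / m := by
      rw [one_div]
      refine tendstoInMeasure_depth_div_log (fun b hb => ?_) fun b hb => ?_
      · have hb0 : 0 < b := (inv_pos.2 hm0).trans hb
        refine tendsto_measureReal_lt_depth hX Real.measurable_log hi
          (fun x _ => Real.le_exp_log x) hb0 ?_
        rw [hmi, neg_lt_neg_iff]
        exact inv_lt_of_inv_lt₀ hm0 hb
      · obtain ⟨b', hb1, hb2⟩ := exists_between (max_lt hb (inv_pos.2 hm0))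
        have hb0 : 0 < b' := (le_max_right _ _).trans_lt hb1
        have hlim := tendsto_measureReal_depth_le hX h0 hi hb0 (by
          rw [hmi, neg_lt_neg_iff]
          exact (lt_inv_comm₀ hb0 hm0).1 hb2)
        refine tendsto_of_tendsto_of_tendsto_of_le_of_le tendsto_const_nhds hlim
          (fun _ => measureReal_nonneg) fun n => measureReal_mono fun ω hω => ?_
        have h1 : (depth (fun i => X i ω) n : ℝ) ≤ b * Real.log n := hω
        exact h1.trans (mul_le_mul_of_nonneg_right ((le_max_left _ _).trans hb1.le)
          (Real.log_natCast_nonneg n))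
    exact ⟨hconv, tendsto_integral_depth_div_log hX (one_div_pos.2 hm0).le hconv⟩
  · have hm0 : 0 < m := hm ▸ toReal_logMean_pos hX h
    have hmi : ∫ x, Real.log x ∂ν = -m := hm ▸ integral_log hX h
    have hσ0 : 0 < σ := hσ ▸ Real.sqrt_pos.2 (ENNReal.toReal_pos hpos.ne' hlt.ne)
    have hv : ∫ x, (Real.log x + m) ^ 2 ∂ν = σ ^ 2 := by
      rw [hσ, Real.sq_sqrt ENNReal.toReal_nonneg, logVar, if_neg h.ne]
      have := variance_eq_integral (μ := ν) (X := fun x => -Real.log x)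
        Real.measurable_log.neg.aemeasurable
      rw [variance, integral_neg, hmi, neg_neg] at this
      rw [this]
      congr 1
      ext x
      ring
    refine tendstoInDistribution_of_tendsto_cdf (fun n => ?_) fun s =>
      tendsto_measureReal_depth_le_normal hX hm0 hσ0 (ae_ne_zero_of_logMean_lt_top h)
        (integrable_log hX h) hmi hv s
    exact ((measurable_from_nat.comp (measurable_depth hX n)).sub_const _).div_const _
  · have hm0 : 0 < m := hm ▸ toReal_logMean_pos hX h
    have hmi : ∫ x, Real.log x ∂ν = -m := hm ▸ integral_log hX h
    have hlm : Measurable fun x : ℝ => -Real.log x := Real.measurable_log.neg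
    rw [logVar, if_neg h.ne, evariance_eq_zero_iff hlm.aemeasurable, integral_neg, hmi, neg_neg] at hzero
    -- Zero variance forces `-log X = m` almost surely, so almost every realisation is the tree with
    -- constant attachment `exp (-m)`.
    have hr : ∀ᵐ x ∂ν, x = Real.exp (-m) := by
      filter_upwards [hzero, hX.ae_mem_Ico, ae_ne_zero_of_logMean_lt_top h] with x h1 h2 h3
      have h4 : -Real.log x = m := h1
      rw [← h4, neg_neg, Real.exp_log (lt_of_le_of_ne h2.1 h3.symm)]
    filter_upwards [hX.ae_of_ae hr] with ω hω
    have hXω : (fun i => X i ω) = fun _ => Real.exp (-m) := funext hω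
    have hlit := isLittleO_depth_const (Real.exp_pos (-m)) (by simpa using hm0)
    rw [Real.log_exp, neg_neg] at hlit
    simpa only [hXω] using hlit
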